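/- A linear probing quotient filter has a cyclic table of $m\ge 1$ slots of $r+3$ bits each ($r \ge 0$), where the value $0$ marks an empty slot, and no status bits. Every element $u$ has a fingerprint consisting of a quotient in $\{0,\dots,m-1\}$ (its canonical slot) and a remainder in $\{1,\dots,2^{r+3}-1\}$. Fingerprints are fully random: those of distinct elements are independent and uniformly distributed. Inserting an element stores its remainder in the first empty slot at or (cyclically) after its canonical slot. A query for $y$ is positive if and only if the remainder of $y$ equals one of the remainders stored between the canonical slot of $y$ and the next empty slot. Let $n<m$ distinct elements be inserted into an empty table, let $\delta=n/m$, let $y$ be an element that was not inserted, and let the false positive rate $p^+$ be the probability that the query for $y$ is positive. Let $L$ be the number of remainders stored between the canonical slot of $y$ and the next empty slot (the number of comparisons of a query that compares all of them), let $C=L+1$ be the number of slots probed by an unsuccessful linear probing search for $y$ (including the empty slot at its end), and let $T\le L$ be the number of stored remainders compared by a query for $y$ that stops at the first match. Then $$p^+=\frac{E[T]}{2^{r+3}-1},\qquad p^+\le\frac{E[L]}{2^{r+3}-1},\qquad E[L]\le E[C]\le\frac12\left(1+\frac1{(1-\delta)^2}\right),$$ and hence $$p^+\le\frac12\left(1+\frac1{(1-\delta)^2}\right)\cdot\frac1{2^{r+3}-1}.$$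 Moreover, the bound on $E[C]$ is asymptotically attained, uniformly for fill degrees bounded away from $1$: for all $\delta_0<1$ and $\varepsilon>0$ there is an $M$ such that $E[C]\ge\frac12\left(1+\frac1{(1-\delta)^2}\right)-\varepsilon$ whenever $m\ge M$ and $\delta=n/m\le\delta_0$. -/

import Mathlib

open MeasureTheory ProbabilityTheory

/-- Remainders of `r + 3` bits; the value `0` is excluded, since it marks empty slots. -/
abbrev Remainder (r : ℕ) : Type := {ρ : Fin (2 ^ (r + 3)) // ρ ≠ 0}

/-- A fingerprint: the quotient (index of the canonical slot) and the non-zero remainder. -/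
abbrev Fingerprint (m r : ℕ) : Type := Fin m × Remainder r

/-- The table of a linear probing quotient filter: `m` slots of `r + 3` bits each and no status
bits. A slot is empty if and only if it contains `0`. -/
abbrev LPTable (m r : ℕ) : Type := Fin m → Fin (2 ^ (r + 3))

namespace LPTable

variable {m r : ℕ} [NeZero m]

/-- The content of the `i`-th slot of the (cyclic) probe sequence that starts in slot `s`. -/
def probe (T : LPTable m r) (s : Fin m) (i : ℕ) : Fin (2 ^ (r + 3)) :=
  T (s + Fin.ofNat m i)

/-- The distance from slot `s` to the first empty slot at or (cyclically) after `s`, in a table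
that is not full. It is the number of remainders stored between `s` and the next empty slot. -/
noncomputable def distToEmpty (T : LPTable m r) (s : Fin m) : ℕ :=
  sInf {i : ℕ | T.probe s i = 0}

/-- Insertion of a fingerprint (into a table that is not full): its remainder is stored in the
first empty slot at or after its canonical slot. -/
noncomputable def insert (T : LPTable m r) (φ : Fingerprint m r) : LPTable m r :=
  Function.update T (φ.1 + Fin.ofNat m (T.distToEmpty φ.1)) φ.2.1

/-- The table after the insertion of a list of fingerprints, one after the other, into an
empty table. -/
noncomputable def build (l : List (Fingerprint m r)) : LPTable m r :=
  l.foldl insert (fun _ => 0)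

/-- The answer of a query is positive: the remainder of the queried fingerprint equals one of the
remainders stored between its canonical slot and the next empty slot. -/
def Query (T : LPTable m r) (φ : Fingerprint m r) : Prop :=
  ∃ i < T.distToEmpty φ.1, T.probe φ.1 i = φ.2.1

/-- The number of stored remainders that a query compares with its own one if it compares all
remainders between its canonical slot and the next empty slot. -/
noncomputable def numComparisons (T : LPTable m r) (φ : Fingerprint m r) : ℕ :=
  T.distToEmpty φ.1

/-- The number of slots probed by an unsuccessful search of linear probing that starts in the
canonical slot: all slots up to and including the first empty one. -/
noncomputable def numProbes (T : LPTable m r) (φ : Fingerprint m r) : ℕ :=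
  T.distToEmpty φ.1 + 1

/-- The number of stored remainders that a query compares with its own one if it scans from its
canonical slot and stops as soon as a match or an empty slot is found: the `i`-th comparison takes
place if and only if none of the comparisons before it was a match. -/
noncomputable def numComparisonsUntilMatch (T : LPTable m r) (φ : Fingerprint m r) : ℕ :=
  ((Finset.range (T.distToEmpty φ.1)).filter (fun i => ∀ j < i, T.probe φ.1 j ≠ φ.2.1)).card

end LPTable

/-- A fully random fingerprint function on the set `U` of all possible elements: the fingerprints
of the elements are independent, and each of them is uniformly distributed. -/
structure IsFullyRandom {Ω U : Type*} [MeasurableSpace Ω] (μ : Measure Ω) {m r : ℕ}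
    (f : U → Ω → Fingerprint m r) : Prop where
  measurable : ∀ u, Measurable (f u)
  indep : iIndepFun f μ
  uniform : ∀ u (a : Fingerprint m r),
    μ.real (f u ⁻¹' {a}) = 1 / ((m : ℝ) * ((2 : ℝ) ^ (r + 3) - 1))

/-- The filter that results from the insertion of the elements `x 0, …, x (n - 1)` into an empty
table, as a function of the random outcome. -/
noncomputable def lpFilter {Ω U : Type*} {m r n : ℕ} [NeZero m]
    (f : U → Ω → Fingerprint m r) (x : Fin n → U) (ω : Ω) : LPTable m r :=
  LPTable.build (List.ofFn (fun i => f (x i) ω))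

/-- The false positive rate: the probability that a query for `y` is answered positively (used for
an element `y` that is not among the inserted ones). -/
noncomputable def falsePositiveRate {Ω U : Type*} [MeasurableSpace Ω] (μ : Measure Ω)
    {m r n : ℕ} [NeZero m] (f : U → Ω → Fingerprint m r) (x : Fin n → U) (y : U) : ℝ :=
  μ.real {ω | (lpFilter f x ω).Query (f y ω)}

/-! Which slots are empty depends only on how many items `X s` have each canonical slot `s`, not on
their order or remainders. If `W s` items are pushed out of `s`, then `W s = W (s - 1) + X s - 1`
(truncated), and `s` is empty iff `W (s - 1) + X s = 0`. An insertion raises `W` by one on each slot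
it passes, so ∑ W grows by exactly the search length (`totalOverflow_succ`), and E[L] is a forward
difference of E[∑ W].

Squaring the recursion and summing around the cycle cancels ∑ W² and expresses 2 ∑ W as a sum over
items (`IsOverflow.two_mul_sum`). Removing the item from the counts in its own term makes its
uniform canonical slot independent of the rest. Averaging gives, for Sₙ = 2 E[∑ W], the recursion
Sₙ₊₁ = (n + 1) / m * (Sₙ + n), solved by Sₙ = m (Qₙ - 1) - n with Qₙ = `knuthQ m n`
(`overflowSum_succ`, `overflowSum_eq`). Hence E[C] = (1 + m (Qₙ₊₁ - Qₙ)) / 2, which `knuthQ_diff_le`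
and `le_knuthQ_diff` estimate.

For the false positive rate, permuting the non-zero values of one slot preserves the law of the
table (`LPTable.sum_build_permSlot`). Whether the `i`-th comparison takes place does not depend on
which non-zero value it meets, so it is a match with conditional probability 1 / (2^(r+3) - 1). At
most one comparison matches; summing over `i` gives the formula with E[T]. -/

/-! ### Cyclic arithmetic of slots. -/

theorem Fin.val_sub_one_of_ne_zero' {m : ℕ} [NeZero m] {k : Fin m} (hk : k ≠ 0) :
    (k - 1).val = k.val - 1 := by
  obtain _ | m := m
  · exact k.elim0
  · rw [Fin.coe_sub_one, if_neg hk]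

theorem Fin.sub_one_sub_val {m : ℕ} [NeZero m] (t q : Fin m) (h : t ≠ q) :
    (t - 1 - q).val = (t - q).val - 1 := by
  rw [sub_right_comm, Fin.val_sub_one_of_ne_zero' (sub_ne_zero.2 h)]

theorem Fin.val_neg_one' {m : ℕ} [NeZero m] : (-1 : Fin m).val = m - 1 := by
  obtain _ | m := m
  · exact (NeZero.ne 0 rfl).elim
  · exact Fin.coe_neg_one

theorem Fin.add_ofNat_val_sub {m : ℕ} [NeZero m] (t q : Fin m) :
    q + Fin.ofNat m (t - q).val = t := by
  rw [Fin.ofNat_val_eq_self]; abel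

theorem Fin.add_ofNat_sub_val {m : ℕ} [NeZero m] (q : Fin m) {i : ℕ} (hi : i < m) :
    (q + Fin.ofNat m i - q).val = i := by
  rw [add_sub_cancel_left, Fin.val_ofNat, Nat.mod_eq_of_lt hi]

/-! ### The overflow recursion. -/

/-- `W s` is the number of items that are pushed from slot `s` into the next slot when `X s` items
have canonical slot `s`, each slot stores one item, and some slot pushes nothing. -/
structure IsOverflow {m : ℕ} [NeZero m] (X W : Fin m → ℕ) : Prop where
  exists_zero : ∃ e, W e = 0
  step : ∀ s, W s = W (s - 1) + X s - 1

namespace IsOverflow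

variable {m : ℕ} [NeZero m] {X W W' : Fin m → ℕ}

/-- Go once around the table from a slot where `W` vanishes: the recursion is monotone in the
previous value. -/
theorem le (h : IsOverflow X W) (h' : IsOverflow X W') : W ≤ W' := by
  obtain ⟨e, he⟩ := h.exists_zero
  have key : ∀ i : ℕ, W (e + Fin.ofNat m i) ≤ W' (e + Fin.ofNat m i) := by
    intro i
    induction i with
    | zero =>
      have : e + Fin.ofNat m 0 = e := by
        rw [show Fin.ofNat m 0 = 0 from rfl, add_zero]
      rw [this, he]; exact Nat.zero_le _
    | succ i ih =>
      have : e + Fin.ofNat m (i + 1) - 1 = e + Fin.ofNat m i := by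
        have h1 : Fin.ofNat m (i + 1) = Fin.ofNat m i + 1 := by
          simp [Fin.ext_iff, Fin.val_add]
        rw [h1, ← add_assoc, add_sub_cancel_right]
      rw [h.step, h'.step, this]
      omega
  intro t
  simpa only [Fin.add_ofNat_val_sub] using key (t - e).val

theorem unique (h : IsOverflow X W) (h' : IsOverflow X W') : W = W' :=
  le_antisymm (h.le h') (h'.le h)

theorem sum_shift (W : Fin m → ℕ) : ∑ s, W (s - 1) = ∑ s, W s :=
  Equiv.sum_comp (Equiv.subRight (1 : Fin m)) W

/-- The number of non-empty slots is the number of items. -/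
theorem sum_occupied (h : IsOverflow X W) :
    ∑ s, min 1 (W (s - 1) + X s) = ∑ s, X s := by
  have h1 : ∑ s, (W s + min 1 (W (s - 1) + X s)) = ∑ s, (W (s - 1) + X s) :=
    Finset.sum_congr rfl fun s _ => by rw [h.step s]; omega
  rw [Finset.sum_add_distrib, Finset.sum_add_distrib, sum_shift] at h1
  omega

theorem exists_empty (h : IsOverflow X W) (hX : ∑ s, X s < m) :
    ∃ s, W (s - 1) + X s = 0 := by
  by_contra! hne
  have := h.sum_occupied
  rw [Finset.sum_congr rfl (g := fun _ => 1) fun s _ => by have := hne s; omega] at this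
  simp at this
  omega

theorem two_mul_sum (h : IsOverflow X W) :
    2 * ∑ s, (W s : ℤ) = ∑ s, (X s : ℤ) * (2 * W (s - 1) + X s - 1) := by
  -- With `Y = W (s - 1) + X s`, we have `W s = Y - min 1 Y`, where `min 1 Y` is its own square and
  -- `Y * min 1 Y = Y`.
  have h1 : ∀ s, (W s : ℤ) ^ 2 = (W (s - 1) + X s) ^ 2 - 2 * (W (s - 1) + X s)
      + ((min 1 (W (s - 1) + X s) : ℕ) : ℤ) := by
    intro s
    rw [h.step s]
    rcases Nat.eq_zero_or_pos (W (s - 1) + X s) with h0 | h0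
    · have : (W (s - 1) : ℤ) + X s = 0 := by exact_mod_cast h0
      rw [h0, this]; simp
    · rw [Nat.min_eq_left h0]
      push_cast [Nat.cast_sub h0]
      ring
  have h2 := Finset.sum_congr rfl fun s (_ : s ∈ Finset.univ) => h1 s
  have h3 : ∑ s, (W (s - 1) : ℤ) = ∑ s, (W s : ℤ) := by exact_mod_cast sum_shift W
  have h4 : ∑ s, (W (s - 1) : ℤ) ^ 2 = ∑ s, (W s : ℤ) ^ 2 := by
    exact_mod_cast sum_shift fun s => W s ^ 2
  have h5 : ∑ s, ((min 1 (W (s - 1) + X s) : ℕ) : ℤ) = ∑ s, (X s : ℤ) := by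
    exact_mod_cast h.sum_occupied
  have h6 : ∀ s, ((W (s - 1) : ℤ) + X s) ^ 2 - 2 * (W (s - 1) + X s)
      + ((min 1 (W (s - 1) + X s) : ℕ) : ℤ)
      = (W (s - 1) : ℤ) ^ 2 + X s * (2 * W (s - 1) + X s - 1) - 2 * W (s - 1) - X s
      + ((min 1 (W (s - 1) + X s) : ℕ) : ℤ) := fun s => by ring
  rw [Finset.sum_congr rfl fun s (_ : s ∈ Finset.univ) => h6 s, Finset.sum_add_distrib,
    Finset.sum_sub_distrib, Finset.sum_sub_distrib, Finset.sum_add_distrib, h4, h5,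
    ← Finset.mul_sum, h3] at h2
  linarith

end IsOverflow

/-! ### Effect of one insertion on the overflow. -/

/-- The indicator of the cyclic interval of length `d` that starts at `q`. -/
def cyclicInterval {m : ℕ} [NeZero m] (q : Fin m) (d : ℕ) (t : Fin m) : ℕ :=
  if (t - q).val < d then 1 else 0

theorem sum_cyclicInterval {m : ℕ} [NeZero m] (q : Fin m) {d : ℕ} (hd : d ≤ m) :
    ∑ t, cyclicInterval q d t = d := by
  have h1 : ∑ t, cyclicInterval q d t = ∑ t : Fin m, if t.val < d then 1 else 0 :=
    Equiv.sum_comp (Equiv.subRight q) fun t : Fin m => if t.val < d then 1 else 0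
  rw [h1, Fin.sum_univ_eq_sum_range (fun i => if i < d then 1 else 0) m, Finset.sum_boole,
    show (Finset.range m).filter (· < d) = Finset.range d by ext; simp; omega]
  simp

section Insertion

variable {m : ℕ} [NeZero m] {X W : Fin m → ℕ} {q : Fin m} {d : ℕ}

theorem cyclicInterval_sub_one (q : Fin m) (hd : d < m) : cyclicInterval q d (q - 1) = 0 := by
  have : (q - 1 - q).val = m - 1 := by
    rw [show q - 1 - q = -1 by abel, Fin.val_neg_one']
  rw [cyclicInterval, if_neg (by omega)]

theorem IsOverflow.insert_aux
    (hlt : ∀ k < d, W (q + Fin.ofNat m k - 1) + X (q + Fin.ofNat m k) ≠ 0) (t : Fin m)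
    (ht : (t - q).val < d) : W (t - 1) + X t ≠ 0 := by
  simpa only [Fin.add_ofNat_val_sub] using hlt _ ht

/-- Insertion of one item: it is pushed to the first empty slot. -/
theorem IsOverflow.insert (h : IsOverflow X W) (hd : d < m)
    (hlt : ∀ k < d, W (q + Fin.ofNat m k - 1) + X (q + Fin.ofNat m k) ≠ 0)
    (h0 : W (q + Fin.ofNat m d - 1) + X (q + Fin.ofNat m d) = 0) :
    IsOverflow (X + Pi.single q 1) (W + cyclicInterval q d) := by
  refine ⟨⟨q + Fin.ofNat m d, ?_⟩, fun t => ?_⟩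
  -- The target slot was empty, so it pushes nothing even after receiving the item.
  · rw [Pi.add_apply, h.step, h0, cyclicInterval, Fin.add_ofNat_sub_val _ hd, if_neg (lt_irrefl _)]
  · have hpos := IsOverflow.insert_aux hlt t
    simp only [Pi.add_apply]
    rw [h.step t]
    by_cases htq : t = q
    · subst htq
      rw [cyclicInterval_sub_one _ hd, Pi.single_eq_same]
      simp only [cyclicInterval, sub_self, Fin.val_zero] at hpos ⊢
      rcases Nat.eq_zero_or_pos d with rfl | hd0
      · have e : t + Fin.ofNat m 0 = t := by rw [show Fin.ofNat m 0 = 0 from rfl, add_zero]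
        rw [e] at h0
        simp; omega
      · have := hpos (by simpa using hd0)
        simp [hd0]; omega
    · have hv : (t - q).val ≠ 0 := fun h => htq (sub_eq_zero.1 (Fin.ext (by simpa using h)))
      rw [Pi.single_eq_of_ne htq]
      simp only [cyclicInterval, Fin.sub_one_sub_val t q htq]
      rcases lt_trichotomy (t - q).val d with hk | hk | hk
      · have := hpos hk
        rw [if_pos hk, if_pos (by omega)]; omega
      · rw [← hk, Fin.add_ofNat_val_sub] at h0
        rw [if_neg (by omega), if_pos (by omega)]; omega
      · rw [if_neg (by omega), if_neg (by omega)]; omega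

/-- Every slot passed on the way was already occupied, so only the target changes state. -/
theorem IsOverflow.insert_empty_iff (hd : d < m)
    (hlt : ∀ k < d, W (q + Fin.ofNat m k - 1) + X (q + Fin.ofNat m k) ≠ 0) (t : Fin m) :
    (W + cyclicInterval q d) (t - 1) + (X + Pi.single q 1 : Fin m → ℕ) t = 0 ↔
      t ≠ q + Fin.ofNat m d ∧ W (t - 1) + X t = 0 := by
  have hpos := IsOverflow.insert_aux hlt t
  have hiff : t = q + Fin.ofNat m d ↔ (t - q).val = d := by
    constructor
    · rintro rfl
      exact Fin.add_ofNat_sub_val _ hd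
    · rintro rfl
      rw [Fin.add_ofNat_val_sub]
  rw [Ne, hiff]
  simp only [Pi.add_apply]
  by_cases htq : t = q
  · subst htq
    rw [Pi.single_eq_same]
    simp only [sub_self, Fin.val_zero] at hpos ⊢
    constructor
    · intro h; omega
    · rintro ⟨h1, h2⟩
      exact absurd h2 (hpos (by omega))
  · have hv : (t - q).val ≠ 0 := fun h => htq (sub_eq_zero.1 (Fin.ext (by simpa using h)))
    rw [Pi.single_eq_of_ne htq]
    simp only [cyclicInterval, Fin.sub_one_sub_val t q htq]
    rcases lt_trichotomy (t - q).val d with hk | hk | hk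
    · have := hpos hk
      rw [if_pos (by omega)]; omega
    · rw [if_pos (by omega)]; omega
    · rw [if_neg (by omega)]; omega

end Insertion

/-! ### Overflow and displacement as functions of the counts. -/

section Overflow

variable {m : ℕ} [NeZero m] {X W : Fin m → ℕ}

/-- The overflow determined by the numbers of items with given canonical slots. -/
noncomputable def overflow (X : Fin m → ℕ) : Fin m → ℕ :=
  open Classical in if h : ∃ W, IsOverflow X W then h.choose else 0

theorem IsOverflow.overflow_eq (h : IsOverflow X W) : overflow X = W := by
  have hex : ∃ W, IsOverflow X W := ⟨W, h⟩
  rw [overflow, dif_pos hex]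
  exact hex.choose_spec.unique h

/-- The displacement of an item with canonical slot `q`. -/
noncomputable def displacement (X : Fin m → ℕ) (q : Fin m) : ℕ :=
  sInf {k | overflow X (q + Fin.ofNat m k - 1) + X (q + Fin.ofNat m k) = 0}

theorem displacement_spec (h : IsOverflow X (overflow X)) (hX : ∑ s, X s < m) (q : Fin m) :
    displacement X q < m ∧
    (∀ k < displacement X q,
      overflow X (q + Fin.ofNat m k - 1) + X (q + Fin.ofNat m k) ≠ 0) ∧
    overflow X (q + Fin.ofNat m (displacement X q) - 1)
      + X (q + Fin.ofNat m (displacement X q)) = 0 := by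
  obtain ⟨e, he⟩ := h.exists_empty hX
  have hmem : (e - q).val ∈
      {k | overflow X (q + Fin.ofNat m k - 1) + X (q + Fin.ofNat m k) = 0} := by
    simpa only [Set.mem_ofPred_eq, Fin.add_ofNat_val_sub] using he
  exact ⟨(Nat.sInf_le hmem).trans_lt (e - q).isLt, fun k hk h0 => hk.not_ge (Nat.sInf_le h0),
    Nat.sInf_mem ⟨_, hmem⟩⟩

theorem isOverflow_insert (h : IsOverflow X (overflow X)) (hX : ∑ s, X s < m) (q : Fin m) :
    IsOverflow (X + Pi.single q 1) (overflow X + cyclicInterval q (displacement X q)) :=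
  have ⟨h1, h2, h3⟩ := displacement_spec h hX q
  h.insert h1 h2 h3

theorem overflow_insert (h : IsOverflow X (overflow X)) (hX : ∑ s, X s < m) (q : Fin m) :
    overflow (X + Pi.single q 1) = overflow X + cyclicInterval q (displacement X q) :=
  (isOverflow_insert h hX q).overflow_eq

end Overflow

/-! ### Sums over all fingerprint sequences. -/

/-- The number of fingerprints with given quotient. -/
def canonicalCount {m r n : ℕ} (g : Fin n → Fingerprint m r) : Fin m → ℕ :=
  fun s => ∑ i, if (g i).1 = s then 1 else 0

section Count

variable {m r n : ℕ}

theorem sum_canonicalCount (g : Fin n → Fingerprint m r) : ∑ s, canonicalCount g s = n := by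
  simp only [canonicalCount]
  rw [Finset.sum_comm]
  simp

theorem canonicalCount_succ (i : Fin (n + 1)) (g : Fin (n + 1) → Fingerprint m r) :
    canonicalCount g = canonicalCount (i.removeNth g) + Pi.single (g i).1 1 := by
  funext s
  rw [Pi.add_apply, canonicalCount, Fin.sum_univ_succAbove _ i, add_comm, Pi.single_apply]
  simp only [eq_comm (a := s)]
  rfl

theorem sum_canonicalCount_mul (g : Fin n → Fingerprint m r) (F : Fin m → ℤ) :
    ∑ s, (canonicalCount g s : ℤ) * F s = ∑ i, F (g i).1 := by
  simp only [canonicalCount]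
  push_cast
  simp only [Finset.sum_mul]
  rw [Finset.sum_comm]
  simp

/-- Finite form of independence: one fingerprint and the remaining ones range freely. -/
theorem sum_removeNth (i : Fin (n + 1)) (Ψ : Fingerprint m r → (Fin n → Fingerprint m r) → ℝ) :
    ∑ g : Fin (n + 1) → Fingerprint m r, Ψ (g i) (i.removeNth g) = ∑ φ, ∑ g, Ψ φ g := by
  rw [← Fintype.sum_prod_type' (f := Ψ)]
  exact Equiv.sum_comp (Fin.insertNthEquiv (fun _ => Fingerprint m r) i).symm
    fun p : Fingerprint m r × (Fin n → Fingerprint m r) => Ψ p.1 p.2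

theorem sum_fingerprint (F : Fin m → ℝ) :
    ∑ φ : Fingerprint m r, F φ.1 = Fintype.card (Remainder r) * ∑ s, F s := by
  rw [Fintype.sum_prod_type]
  simp [Finset.mul_sum]

variable [NeZero m]

theorem LPTable.build_succ (g : Fin (n + 1) → Fingerprint m r) :
    LPTable.build (List.ofFn g) =
      (LPTable.build (List.ofFn ((Fin.last n).removeNth g))).insert (g (Fin.last n)) := by
  rw [List.ofFn_succ', List.concat_eq_append, LPTable.build, List.foldl_append, Fin.removeNth_last]
  rfl

theorem distToEmpty_eq_displacement {T : LPTable m r} {X : Fin m → ℕ}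
    (h : ∀ t, T t = 0 ↔ overflow X (t - 1) + X t = 0) (q : Fin m) :
    T.distToEmpty q = displacement X q := by
  simp only [LPTable.distToEmpty, LPTable.probe, h, displacement]

/-- By induction, each insertion fills the same slot in the table and in the overflow model. A full
table is allowed because `sum_distToEmpty` also involves `n + 1` items. -/
theorem isOverflow_and_empty_iff (hn : n ≤ m) (g : Fin n → Fingerprint m r) :
    IsOverflow (canonicalCount g) (overflow (canonicalCount g)) ∧
    ∀ t, LPTable.build (List.ofFn g) t = 0 ↔
      overflow (canonicalCount g) (t - 1) + canonicalCount g t = 0 := by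
  induction n with
  | zero =>
    have h0 : canonicalCount g = 0 := by funext s; simp [canonicalCount]
    have h1 : IsOverflow (canonicalCount g) 0 := ⟨⟨0, rfl⟩, fun s => by simp [h0]⟩
    rw [h1.overflow_eq]
    exact ⟨h1, fun t => by simp [h0, LPTable.build]⟩
  | succ n ih =>
    obtain ⟨h1, h2⟩ := ih (by omega) ((Fin.last n).removeNth g)
    have hX : ∑ s, canonicalCount ((Fin.last n).removeNth g) s < m := by
      rw [sum_canonicalCount]; omega
    obtain ⟨hd, hlt, -⟩ := displacement_spec h1 hX (g (Fin.last n)).1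
    rw [canonicalCount_succ (Fin.last n), overflow_insert h1 hX]
    refine ⟨isOverflow_insert h1 hX _, fun t => ?_⟩
    rw [IsOverflow.insert_empty_iff hd hlt t, LPTable.build_succ, LPTable.insert,
      distToEmpty_eq_displacement h2, ← h2, Function.update_apply]
    split_ifs with ht
    · simpa [ht] using (g (Fin.last n)).2.2
    · simp only [ne_eq, ht, not_false_eq_true, true_and]

theorem distToEmpty_build (hn : n ≤ m) (g : Fin n → Fingerprint m r) (q : Fin m) :
    (LPTable.build (List.ofFn g)).distToEmpty q = displacement (canonicalCount g) q :=
  distToEmpty_eq_displacement (isOverflow_and_empty_iff hn g).2 q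

/-- The total displacement of all items. -/
noncomputable def totalOverflow (g : Fin n → Fingerprint m r) : ℕ :=
  ∑ s, overflow (canonicalCount g) s

theorem totalOverflow_succ (hn : n < m) (g : Fin (n + 1) → Fingerprint m r) :
    totalOverflow g = totalOverflow ((Fin.last n).removeNth g) +
      (LPTable.build (List.ofFn ((Fin.last n).removeNth g))).distToEmpty (g (Fin.last n)).1 := by
  have h1 := (isOverflow_and_empty_iff hn.le ((Fin.last n).removeNth g)).1
  have hX : ∑ s, canonicalCount ((Fin.last n).removeNth g) s < m := by
    rw [sum_canonicalCount]; omega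
  rw [totalOverflow, canonicalCount_succ (Fin.last n), overflow_insert h1 hX,
    distToEmpty_build hn.le]
  simp only [Pi.add_apply]
  rw [Finset.sum_add_distrib, sum_cyclicInterval _ (displacement_spec h1 hX _).1.le]
  rfl

/-- Inserting item `i` last leaves the overflow into its canonical slot unchanged, as its
displacement is less than `m`; its own share of the count cancels the `- 1` of `two_mul_sum`. -/
theorem two_mul_totalOverflow (hn : n < m) (g : Fin (n + 1) → Fingerprint m r) :
    2 * (totalOverflow g : ℤ) = ∑ i : Fin (n + 1),
      (2 * (overflow (canonicalCount (i.removeNth g)) ((g i).1 - 1) : ℤ)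
        + canonicalCount (i.removeNth g) (g i).1) := by
  have h := (isOverflow_and_empty_iff hn g).1.two_mul_sum
  rw [totalOverflow, Nat.cast_sum, h, sum_canonicalCount_mul]
  refine Finset.sum_congr rfl fun i _ => ?_
  have h1 := (isOverflow_and_empty_iff hn.le (i.removeNth g)).1
  have hX : ∑ s, canonicalCount (i.removeNth g) s < m := by
    rw [sum_canonicalCount]; omega
  rw [canonicalCount_succ i g, overflow_insert h1 hX, Pi.add_apply, Pi.add_apply,
    cyclicInterval_sub_one _ (displacement_spec h1 hX _).1, Pi.single_eq_same]
  push_cast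
  ring

variable (m r n) in
/-- The sum of twice the total displacement over all sequences of fingerprints. -/
noncomputable def overflowSum : ℝ := ∑ g : Fin n → Fingerprint m r, 2 * (totalOverflow g : ℝ)

theorem overflowSum_zero : overflowSum m r 0 = 0 := by
  have h : ∀ g : Fin 0 → Fingerprint m r, totalOverflow g = 0 := by
    intro g
    have h0 : canonicalCount g = 0 := by funext s; simp [canonicalCount]
    have h1 : IsOverflow (canonicalCount g) 0 := ⟨⟨0, rfl⟩, fun s => by simp [h0]⟩
    rw [totalOverflow, h1.overflow_eq]
    simp
  simp [overflowSum, h]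

/-- All `n + 1` items contribute equally; summing over the free canonical slot of one turns its term
into twice the total overflow of the others plus `n`. -/
theorem overflowSum_succ (hn : n < m) :
    overflowSum m r (n + 1) = (n + 1) * Fintype.card (Remainder r) *
      (overflowSum m r n + n * (Fintype.card (Fingerprint m r) : ℝ) ^ n) := by
  let Ψ : Fingerprint m r → (Fin n → Fingerprint m r) → ℝ := fun φ g =>
    2 * (overflow (canonicalCount g) (φ.1 - 1) : ℝ) + canonicalCount g φ.1
  have h1 : ∀ g : Fin (n + 1) → Fingerprint m r,
      2 * (totalOverflow g : ℝ) = ∑ i, Ψ (g i) (i.removeNth g) := fun g => by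
    have := congrArg (Int.cast : ℤ → ℝ) (two_mul_totalOverflow hn g)
    push_cast at this
    exact this
  have h2 : ∀ g : Fin n → Fingerprint m r,
      ∑ φ, Ψ φ g = Fintype.card (Remainder r) * (2 * (totalOverflow g : ℝ) + n) := fun g => by
    have h3 : ∑ s, (overflow (canonicalCount g) (s - 1) : ℝ) = totalOverflow g := by
      exact_mod_cast IsOverflow.sum_shift (overflow (canonicalCount g))
    have h4 : ∑ s, (canonicalCount g s : ℝ) = n := by exact_mod_cast sum_canonicalCount g
    rw [sum_fingerprint fun s => 2 * (overflow (canonicalCount g) (s - 1) : ℝ)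
      + canonicalCount g s, Finset.sum_add_distrib, ← Finset.mul_sum, h3, h4]
  rw [overflowSum, Finset.sum_congr rfl fun g _ => h1 g, Finset.sum_comm]
  simp only [sum_removeNth _ Ψ]
  rw [Finset.sum_comm (γ := Fingerprint m r), Finset.sum_congr rfl fun g _ => h2 g,
    ← Finset.mul_sum, Finset.sum_add_distrib, overflowSum]
  simp
  ring

theorem sum_distToEmpty (hn : n < m) :
    2 * ∑ g : Fin n → Fingerprint m r, ∑ φ : Fingerprint m r,
      ((LPTable.build (List.ofFn g)).distToEmpty φ.1 : ℝ) =
    overflowSum m r (n + 1) - Fintype.card (Fingerprint m r) * overflowSum m r n := by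
  have h := sum_removeNth (Fin.last n) fun (φ : Fingerprint m r) (g : Fin n → Fingerprint m r) =>
    2 * ((totalOverflow g : ℝ) + (LPTable.build (List.ofFn g)).distToEmpty φ.1)
  rw [overflowSum]
  simp only [totalOverflow_succ hn, Nat.cast_add]
  rw [h, Finset.sum_comm (γ := Fin n → Fingerprint m r)]
  simp only [mul_add, Finset.sum_add_distrib, overflowSum, Finset.sum_const, Finset.card_univ,
    nsmul_eq_mul, ← Finset.mul_sum]
  ring

end Count

/-! ### Estimates for Knuth's function. -/

/-- Knuth's function `Q₀(m, n)`, the sum of `n (n - 1) ⋯ (n - k + 1) / m ^ k` over all `k`. -/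
noncomputable def knuthQ (m : ℝ) : ℕ → ℝ
  | 0 => 1
  | n + 1 => 1 + (n + 1) / m * knuthQ m n

/-- The forward difference of Knuth's function `Q₀`, which is `Q₁ / m`. -/
theorem knuthQ_diff_succ {m : ℝ} (hm : 0 < m) (n : ℕ) :
    m * (knuthQ m (n + 2) - knuthQ m (n + 1)) =
      knuthQ m (n + 1) + (n + 1) / m * (m * (knuthQ m (n + 1) - knuthQ m n)) := by
  simp only [knuthQ]
  push_cast
  field_simp
  ring

theorem knuthQ_diff_zero {m : ℝ} (hm : 0 < m) : m * (knuthQ m 1 - knuthQ m 0) = 1 := by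
  simp [knuthQ]
  field_simp

/-- `1 / (1 - x)` is the fixed point of `q ↦ 1 + x * q`, and it grows with `x = n / m`, so the
recursion stays below it. -/
theorem knuthQ_le {m : ℝ} (hm : 0 < m) (n : ℕ) (hn : n < m) :
    knuthQ m n ≤ 1 / (1 - n / m) := by
  induction n with
  | zero => simp [knuthQ]
  | succ n ih =>
    have h1 : (n : ℝ) < m := by push_cast at hn; linarith
    have h2 : (0 : ℝ) < 1 - n / m := by rw [sub_pos, div_lt_one hm]; exact h1
    have h3 : (0 : ℝ) < 1 - (n + 1 : ℕ) / m := by rw [sub_pos, div_lt_one hm]; exact hn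
    have h4 : (1 : ℝ) / (1 - n / m) ≤ 1 / (1 - (n + 1 : ℕ) / m) := by
      apply one_div_le_one_div_of_le h3
      gcongr
      simp
    calc knuthQ m (n + 1) = 1 + (n + 1 : ℕ) / m * knuthQ m n := by simp [knuthQ]
      _ ≤ 1 + (n + 1 : ℕ) / m * (1 / (1 - (n + 1 : ℕ) / m)) := by
        gcongr
        exact (ih h1).trans h4
      _ = 1 / (1 - (n + 1 : ℕ) / m) := by
        have := h3.ne'
        generalize ((n + 1 : ℕ) : ℝ) / m = y at this ⊢
        field_simp
        ring

/-- Same argument with `1 / (1 - x) ^ 2`, the fixed point of `q ↦ 1 / (1 - x) + x * q`. -/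
theorem knuthQ_diff_le {m : ℝ} (hm : 0 < m) (n : ℕ) (hn : n < m) :
    m * (knuthQ m (n + 1) - knuthQ m n) ≤ 1 / (1 - n / m) ^ 2 := by
  induction n with
  | zero => rw [knuthQ_diff_zero hm]; simp
  | succ n ih =>
    have h1 : (n : ℝ) < m := by push_cast at hn; linarith
    have h3 : (0 : ℝ) < 1 - (n + 1 : ℕ) / m := by rw [sub_pos, div_lt_one hm]; exact hn
    have h4 : (1 : ℝ) / (1 - n / m) ^ 2 ≤ 1 / (1 - (n + 1 : ℕ) / m) ^ 2 := by
      apply one_div_le_one_div_of_le (by positivity)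
      gcongr
      simp
    rw [knuthQ_diff_succ hm]
    calc _ ≤ 1 / (1 - (n + 1 : ℕ) / m) + (n + 1 : ℕ) / m * (1 / (1 - (n + 1 : ℕ) / m) ^ 2) := by
          push_cast
          push_cast at h4
          have := knuthQ_le hm (n + 1) hn
          push_cast at this
          gcongr
          exact (ih h1).trans h4
      _ = _ := by field_simp; ring

/-- The fixed point moves by at most `(1 / a ^ 2) / m` per step, while the old error is multiplied
by `y ≤ 1 - a`; an error of `1 / a` times that movement therefore persists. -/
theorem le_knuthQ {m a : ℝ} (hm : 0 < m) (ha : 0 < a) (n : ℕ) (hn : n / m ≤ 1 - a) :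
    1 / (1 - n / m) - (1 / a ^ 3) / m ≤ knuthQ m n := by
  induction n with
  | zero =>
    simp only [Nat.cast_zero, zero_div, sub_zero, div_one, knuthQ, sub_le_self_iff]
    positivity
  | succ n ih =>
    have h0 : (n : ℝ) / m ≤ (n + 1 : ℕ) / m := by gcongr; simp
    have h1 := ih (h0.trans hn)
    set x : ℝ := n / m with hx
    set y : ℝ := (n + 1 : ℕ) / m with hy
    have hxy : y = x + 1 / m := by rw [hx, hy]; push_cast; ring
    have hy0 : 0 ≤ y := by positivity
    have hya : a ≤ 1 - y := by linarith
    have hxa : a ≤ 1 - x := by linarith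
    have hd : 1 / (1 - y) - 1 / (1 - x) ≤ (1 / a ^ 2) / m := by
      have : 1 / (1 - y) - 1 / (1 - x) = (1 / ((1 - y) * (1 - x))) / m := by
        have : (1 - y) ≠ 0 := by linarith
        have : (1 - x) ≠ 0 := by linarith
        rw [div_sub_div _ _ (by assumption) (by assumption), hxy, div_div]
        field_simp
        ring
      rw [this]
      gcongr
      nlinarith
    calc 1 / (1 - y) - (1 / a ^ 3) / m
        = 1 + y * (1 / (1 - y)) - (1 / a ^ 3) / m := by
          have : (1 - y) ≠ 0 := by linarith
          field_simp; ring
      _ ≤ 1 + y * (1 / (1 - y) - ((1 / a ^ 2) / m + (1 / a ^ 3) / m)) := by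
          have e : (1 / a ^ 2) / m = a * ((1 / a ^ 3) / m) := by field_simp
          have hp : 0 < (1 / a ^ 3) / m := by positivity
          have : y * (1 + a) ≤ 1 := by nlinarith
          rw [e]
          nlinarith
      _ ≤ 1 + y * knuthQ m n := by
          gcongr
          linarith
      _ = knuthQ m (n + 1) := by simp [knuthQ, hy]

/-- `3 / a ^ 4` is `1 / a` times the sum of the two errors of a step: `2 / a ^ 3` from the moving
fixed point and `1 / a ^ 3` from `le_knuthQ`. -/
theorem le_knuthQ_diff {m a : ℝ} (hm : 0 < m) (ha : 0 < a) (n : ℕ) (hn : n / m ≤ 1 - a) :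
    1 / (1 - n / m) ^ 2 - (3 / a ^ 4) / m ≤ m * (knuthQ m (n + 1) - knuthQ m n) := by
  induction n with
  | zero =>
    rw [knuthQ_diff_zero hm]
    simp only [Nat.cast_zero, zero_div, sub_zero, one_pow, div_one, sub_le_self_iff]
    positivity
  | succ n ih =>
    have h0 : (n : ℝ) / m ≤ (n + 1 : ℕ) / m := by gcongr; simp
    have h1 := ih (h0.trans hn)
    have h2 := le_knuthQ hm ha _ hn
    rw [knuthQ_diff_succ hm]
    have hc : ((n : ℝ) + 1) / m = (n + 1 : ℕ) / m := by push_cast; ring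
    rw [hc]
    set c := m * (knuthQ m (n + 1) - knuthQ m n)
    set x : ℝ := n / m with hx
    set y : ℝ := (n + 1 : ℕ) / m with hy
    have hxy : y = x + 1 / m := by rw [hx, hy]; push_cast; ring
    have hy0 : 0 ≤ y := by positivity
    have hya : a ≤ 1 - y := by linarith
    have hxa : a ≤ 1 - x := by linarith
    have hY : 1 / (1 - y) ≤ 1 / a := one_div_le_one_div_of_le ha hya
    have hX : 1 / (1 - x) ≤ 1 / a := one_div_le_one_div_of_le ha hxa
    have hd : 1 / (1 - y) ^ 2 - 1 / (1 - x) ^ 2 ≤ (2 / a ^ 3) / m := by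
      have hy1 : (1 - y) ≠ 0 := by linarith
      have hx1 : (1 - x) ≠ 0 := by linarith
      have hyp : 0 < 1 / (1 - y) := one_div_pos.2 (by linarith)
      have hxp : 0 < 1 / (1 - x) := one_div_pos.2 (by linarith)
      have e1 : 1 / (1 - y) ^ 2 - 1 / (1 - x) ^ 2 =
          (1 / (1 - y) * (1 / (1 - x)) * (1 / (1 - y) + 1 / (1 - x))) * (1 / m) := by
        rw [show 1 / m = (1 - x) - (1 - y) by rw [hxy]; ring]
        field_simp
        ring
      have e2 : (2 / a ^ 3) / m = (1 / a * (1 / a) * (1 / a + 1 / a)) * (1 / m) := by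
        field_simp; norm_num
      rw [e1, e2]
      gcongr
    have e : (1 / a ^ 3) / m = a / 3 * ((3 / a ^ 4) / m) := by field_simp
    have e' : (2 / a ^ 3) / m = 2 * a / 3 * ((3 / a ^ 4) / m) := by field_simp
    have hp : 0 < (3 / a ^ 4) / m := by positivity
    calc 1 / (1 - y) ^ 2 - (3 / a ^ 4) / m
        = 1 / (1 - y) + y * (1 / (1 - y) ^ 2) - (3 / a ^ 4) / m := by
          have : (1 - y) ≠ 0 := by linarith
          field_simp; ring
      _ ≤ (1 / (1 - y) - (1 / a ^ 3) / m) +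
            y * (1 / (1 - y) ^ 2 - ((2 / a ^ 3) / m + (3 / a ^ 4) / m)) := by
          rw [e, e']
          set p := (3 / a ^ 4) / m
          have : a / 3 + y * (2 * a / 3 + 1) ≤ 1 := by nlinarith
          nlinarith
      _ ≤ knuthQ m (n + 1) + y * c := by
          gcongr
          linarith

/-! ### Symmetry of the stored remainders. -/

theorem perm_eq_zero_iff {r : ℕ} {π : Equiv.Perm (Fin (2 ^ (r + 3)))} (hπ : π 0 = 0)
    (x : Fin (2 ^ (r + 3))) : π x = 0 ↔ x = 0 :=
  ⟨fun h => π.injective (h.trans hπ.symm), fun h => h ▸ hπ⟩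

namespace LPTable

variable {m r : ℕ} [NeZero m]

/-- The table in which the content of slot `t` is permuted. -/
def permSlot (t : Fin m) (π : Equiv.Perm (Fin (2 ^ (r + 3)))) (T : LPTable m r) : LPTable m r :=
  Function.update T t (π (T t))

variable {t : Fin m} {π : Equiv.Perm (Fin (2 ^ (r + 3)))}

omit [NeZero m] in
theorem permSlot_eq_zero_iff (hπ : π 0 = 0) (T : LPTable m r) (s : Fin m) :
    permSlot t π T s = 0 ↔ T s = 0 := by
  rw [permSlot, Function.update_apply]
  split_ifs with h
  · rw [h, perm_eq_zero_iff hπ]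
  · rfl

theorem distToEmpty_permSlot (hπ : π 0 = 0) (T : LPTable m r) (q : Fin m) :
    (permSlot t π T).distToEmpty q = T.distToEmpty q := by
  simp only [distToEmpty, probe, permSlot_eq_zero_iff hπ]

/-- The permutation of the non-zero remainders that is induced by a permutation that fixes `0`. -/
def remainderPerm (hπ : π 0 = 0) : Equiv.Perm (Remainder r) :=
  π.subtypePerm fun x => by
    rw [Ne, Ne, perm_eq_zero_iff hπ]

/-- Both tables have the same empty slots, hence the same target; only an item landing in `t` needs
its remainder permuted. -/
theorem insert_permSlot (hπ : π 0 = 0) (T : LPTable m r) (q : Fin m) (ρ : Remainder r) :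
    permSlot t π (T.insert (q, ρ)) = (permSlot t π T).insert
      (q, if q + Fin.ofNat m (T.distToEmpty q) = t then remainderPerm hπ ρ else ρ) := by
  simp only [insert, distToEmpty_permSlot hπ]
  split_ifs with h
  · rw [h]
    simp [permSlot, remainderPerm]
  · simp only [permSlot]
    rw [Function.update_of_ne (Ne.symm h), Function.update_comm h]

theorem sum_insert_permSlot (hπ : π 0 = 0) (T : LPTable m r) (F : LPTable m r → ℝ) :
    ∑ φ, F (permSlot t π (T.insert φ)) = ∑ φ, F ((permSlot t π T).insert φ) := by
  rw [Fintype.sum_prod_type, Fintype.sum_prod_type]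
  refine Finset.sum_congr rfl fun q _ => ?_
  simp only [insert_permSlot hπ]
  split_ifs with h
  · exact Equiv.sum_comp (remainderPerm hπ) fun ρ => F ((permSlot t π T).insert (q, ρ))
  · rfl

/-- The permutation is absorbed, insertion by insertion, into a bijection of the remainders of items
landing in `t`. -/
theorem sum_build_permSlot {n : ℕ} (hπ : π 0 = 0) (F : LPTable m r → ℝ) :
    ∑ g : Fin n → Fingerprint m r, F (permSlot t π (build (List.ofFn g))) =
      ∑ g : Fin n → Fingerprint m r, F (build (List.ofFn g)) := by
  induction n generalizing F with
  | zero =>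
    refine Finset.sum_congr rfl fun g _ => ?_
    congr 1
    funext s
    simp [build, permSlot, Function.update_apply, hπ]
  | succ n ih =>
    simp only [build_succ]
    rw [sum_removeNth (Fin.last n) fun φ g => F (permSlot t π ((build (List.ofFn g)).insert φ)),
      sum_removeNth (Fin.last n) fun φ g => F ((build (List.ofFn g)).insert φ),
      Finset.sum_comm, Finset.sum_comm (γ := Fingerprint m r)]
    simp only [sum_insert_permSlot hπ]
    exact ih fun T => ∑ φ, F (T.insert φ)

theorem distToEmpty_lt (T : LPTable m r) (s : Fin m) : T.distToEmpty s < m := by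
  rcases Set.eq_empty_or_nonempty {i : ℕ | T.probe s i = 0} with h | ⟨i, hi⟩
  -- In a full table the infimum takes the default value `0`.
  · rw [distToEmpty, h, Nat.sInf_empty]
    exact Nat.pos_of_ne_zero (NeZero.ne m)
  · have hmod : Fin.ofNat m (i % m) = Fin.ofNat m i := by simp [Fin.ext_iff]
    have : i % m ∈ {i : ℕ | T.probe s i = 0} := by
      simpa only [Set.mem_ofPred_eq, probe, hmod] using hi
    exact (Nat.sInf_le this).trans_lt (Nat.mod_lt _ (Nat.pos_of_ne_zero (NeZero.ne m)))

/-- The `i`-th comparison of a query that stops at the first match takes place. -/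
def Compares (T : LPTable m r) (φ : Fingerprint m r) (i : ℕ) : Prop :=
  i < T.distToEmpty φ.1 ∧ ∀ j < i, T.probe φ.1 j ≠ φ.2.1

open Classical in
theorem numComparisonsUntilMatch_eq_sum (T : LPTable m r) (φ : Fingerprint m r) :
    (T.numComparisonsUntilMatch φ : ℝ) =
      ∑ i ∈ Finset.range m, if T.Compares φ i then 1 else 0 := by
  rw [Finset.sum_boole, numComparisonsUntilMatch]
  refine congrArg (fun s : Finset ℕ => (s.card : ℝ)) (Finset.ext fun i => ?_)
  have := T.distToEmpty_lt φ.1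
  rw [Finset.mem_filter, Finset.mem_filter, Finset.mem_range, Finset.mem_range, Compares]
  constructor
  · rintro ⟨h1, h2⟩; exact ⟨h1.trans this, h1, h2⟩
  · rintro ⟨-, h1, h2⟩; exact ⟨h1, h2⟩

open Classical in
-- Stopping at the first match leaves at most one matching comparison.
theorem ite_query_eq_sum (T : LPTable m r) (φ : Fingerprint m r) :
    (if T.Query φ then 1 else 0 : ℝ) =
      ∑ i ∈ Finset.range m, if T.Compares φ i ∧ T.probe φ.1 i = φ.2.1 then 1 else 0 := by
  split_ifs with h
  · obtain ⟨h1, h2⟩ := Nat.find_spec h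
    have hmin : ∀ j < Nat.find h, T.probe φ.1 j ≠ φ.2.1 := fun j hj h3 =>
      Nat.find_min h hj ⟨hj.trans h1, h3⟩
    rw [Finset.sum_eq_single_of_mem (Nat.find h)
      (Finset.mem_range.2 (h1.trans (T.distToEmpty_lt _))), if_pos ⟨⟨h1, hmin⟩, h2⟩]
    rintro j - hj
    rw [if_neg]
    rintro ⟨⟨h3, h4⟩, h5⟩
    rcases lt_or_gt_of_ne hj with h6 | h6
    · exact hmin j h6 h5
    · exact h4 _ h6 h2
  · symm
    refine Finset.sum_eq_zero fun i _ => if_neg ?_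
    rintro ⟨⟨h1, -⟩, h2⟩
    exact h ⟨i, h1, h2⟩

theorem probe_permSlot_of_ne (T : LPTable m r) (q : Fin m) {i j : ℕ} (hi : i < m) (hj : j < m)
    (hij : j ≠ i) : (permSlot (q + Fin.ofNat m i) π T).probe q j = T.probe q j := by
  rw [probe, probe, permSlot, Function.update_of_ne]
  intro h
  have := congrArg Fin.val (add_left_cancel h)
  rw [Fin.val_ofNat, Fin.val_ofNat, Nat.mod_eq_of_lt hi, Nat.mod_eq_of_lt hj] at this
  exact hij this

/-- The slots compared earlier differ from the permuted one because `i < m`. -/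
theorem compares_permSlot (hπ : π 0 = 0) (T : LPTable m r) (φ : Fingerprint m r) {i : ℕ}
    (hi : i < m) : (permSlot (φ.1 + Fin.ofNat m i) π T).Compares φ i ↔ T.Compares φ i := by
  rw [Compares, Compares, distToEmpty_permSlot hπ]
  refine and_congr_right fun _ => forall₂_congr fun j hj => ?_
  rw [probe_permSlot_of_ne T φ.1 hi (hj.trans hi) hj.ne]

open Classical in
/-- Each comparison is a match with the same probability. -/
theorem sum_compares {n : ℕ} (φ : Fingerprint m r) {i : ℕ} (hi : i < m) :
    ∑ g : Fin n → Fingerprint m r, (if (build (List.ofFn g)).Compares φ i then 1 else 0 : ℝ) =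
      Fintype.card (Remainder r) * ∑ g : Fin n → Fingerprint m r,
        if (build (List.ofFn g)).Compares φ i ∧ (build (List.ofFn g)).probe φ.1 i = φ.2.1
          then 1 else 0 := by
  have h1 : ∀ T : LPTable m r, (if T.Compares φ i then 1 else 0 : ℝ) =
      ∑ ρ : Remainder r, if T.Compares φ i ∧ T.probe φ.1 i = ρ.1 then 1 else 0 := by
    intro T
    split_ifs with h
    · have h0 : T.probe φ.1 i ≠ 0 := fun h0 => h.1.not_ge (Nat.sInf_le h0)
      rw [Finset.sum_eq_single_of_mem ⟨_, h0⟩ (Finset.mem_univ _), if_pos ⟨h, rfl⟩]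
      intro ρ _ hρ
      exact if_neg fun h2 => hρ (Subtype.ext h2.2.symm)
    · simp [h]
  have h2 : ∀ ρ : Remainder r,
      ∑ g : Fin n → Fingerprint m r, (if (build (List.ofFn g)).Compares φ i ∧
        (build (List.ofFn g)).probe φ.1 i = ρ.1 then 1 else 0 : ℝ) =
      ∑ g : Fin n → Fingerprint m r, if (build (List.ofFn g)).Compares φ i ∧
        (build (List.ofFn g)).probe φ.1 i = φ.2.1 then 1 else 0 := by
    intro ρ
    -- The swap exchanges two non-zero values; applied to the `i`-th probed slot, it carries one
    -- match event to the other.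
    have hπ : Equiv.swap ρ.1 φ.2.1 0 = 0 := Equiv.swap_apply_of_ne_of_ne ρ.2.symm φ.2.2.symm
    rw [← sum_build_permSlot (t := φ.1 + Fin.ofNat m i) hπ
      fun T => if T.Compares φ i ∧ T.probe φ.1 i = ρ.1 then 1 else 0]
    refine Finset.sum_congr rfl fun g _ => ?_
    have : (permSlot (φ.1 + Fin.ofNat m i) (Equiv.swap ρ.1 φ.2.1) (build (List.ofFn g))).probe
        φ.1 i = ρ.1 ↔ (build (List.ofFn g)).probe φ.1 i = φ.2.1 := by
      rw [probe, probe, permSlot, Function.update_self, Equiv.swap_apply_eq_iff,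
        Equiv.swap_apply_left]
    simp only [compares_permSlot hπ _ φ hi, this]
  simp only [h1]
  rw [Finset.sum_comm, Finset.sum_congr rfl fun ρ _ => h2 ρ]
  simp

open Classical in
/-- The sum over all tables of the lengths of the searches that stop at the first match. -/
theorem sum_numComparisonsUntilMatch {n : ℕ} (φ : Fingerprint m r) :
    ∑ g : Fin n → Fingerprint m r, ((build (List.ofFn g)).numComparisonsUntilMatch φ : ℝ) =
      Fintype.card (Remainder r) * ∑ g : Fin n → Fingerprint m r,
        if (build (List.ofFn g)).Query φ then 1 else 0 := by
  simp only [numComparisonsUntilMatch_eq_sum, ite_query_eq_sum]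
  rw [Finset.sum_comm, Finset.sum_comm (s := Finset.univ), Finset.mul_sum]
  exact Finset.sum_congr rfl fun i hi => sum_compares φ (Finset.mem_range.1 hi)

end LPTable

/-! ### Cardinalities and closed forms. -/

theorem card_remainder (r : ℕ) :
    (Fintype.card (Remainder r) : ℝ) = (2 : ℝ) ^ (r + 3) - 1 := by
  rw [Fintype.card_subtype_compl, Fintype.card_fin, Fintype.card_subtype_eq,
    Nat.cast_sub Nat.one_le_two_pow]
  push_cast
  rfl

theorem card_fingerprint (m r : ℕ) :
    (Fintype.card (Fingerprint m r) : ℝ) = m * ((2 : ℝ) ^ (r + 3) - 1) := by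
  rw [Fintype.card_prod, Fintype.card_fin, Nat.cast_mul, card_remainder]

theorem remainder_count_pos (r : ℕ) : (0 : ℝ) < (2 : ℝ) ^ (r + 3) - 1 :=
  sub_pos.2 (one_lt_pow₀ one_lt_two (by omega))

theorem overflowSum_eq {m r n : ℕ} [NeZero m] (hn : n ≤ m) :
    overflowSum m r n =
      (Fintype.card (Fingerprint m r) : ℝ) ^ n * (m * (knuthQ m n - 1) - n) := by
  have hm : (m : ℝ) ≠ 0 := Nat.cast_ne_zero.2 (NeZero.ne m)
  induction n with
  | zero => simp [overflowSum_zero, knuthQ]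
  | succ n ih =>
    rw [overflowSum_succ hn, ih (by omega), knuthQ,
      pow_succ (Fintype.card (Fingerprint m r) : ℝ), card_remainder, card_fingerprint]
    push_cast
    field_simp
    ring

theorem sum_distToEmpty_eq {m r n : ℕ} [NeZero m] (hn : n < m) :
    ∑ g : Fin n → Fingerprint m r, ∑ φ : Fingerprint m r,
      ((LPTable.build (List.ofFn g)).distToEmpty φ.1 : ℝ) =
    (Fintype.card (Fingerprint m r) : ℝ) ^ (n + 1) *
      ((m * (knuthQ m (n + 1) - knuthQ m n) - 1) / 2) := by
  have h := sum_distToEmpty (r := r) hn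
  rw [overflowSum_eq (n := n + 1) hn, overflowSum_eq hn.le] at h
  push_cast at h
  linear_combination h / 2

/-! ### From finite sums to expectations. -/

namespace IsFullyRandom

variable {Ω U : Type*} [MeasurableSpace Ω] {μ : Measure Ω} {m r n : ℕ}
  {f : U → Ω → Fingerprint m r} {x : Fin n → U} {y : U}

theorem measureReal_preimage (h : IsFullyRandom μ f) {z : Fin n → U} (hz : Function.Injective z)
    (a : Fin n → Fingerprint m r) :
    μ.real ((fun ω i => f (z i) ω) ⁻¹' {a}) =
      1 / (Fintype.card (Fingerprint m r) : ℝ) ^ n := by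
  have h1 : (fun ω i => f (z i) ω) ⁻¹' {a} =
      ⋂ i ∈ (Finset.univ : Finset (Fin n)), f (z i) ⁻¹' {a i} := by
    ext ω
    simp [funext_iff]
  have h2 := (h.indep.precomp hz).measure_inter_preimage_eq_mul Finset.univ
    (sets := fun i => {a i}) fun i _ => measurableSet_singleton _
  rw [h1, Measure.real, h2, ENNReal.toReal_prod]
  have h3 : ∀ i, (μ (f (z i) ⁻¹' {a i})).toReal = 1 / (Fintype.card (Fingerprint m r) : ℝ) :=
    fun i => by rw [card_fingerprint]; exact h.uniform (z i) (a i)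
  simp only [h3]
  rw [Finset.prod_const, Finset.card_univ, Fintype.card_fin, one_div_pow]

/-- Appending `y` to the inserted elements gives `n + 1` distinct elements with jointly uniform
fingerprints, so the expectation is an average. -/
theorem integral_eq [IsProbabilityMeasure μ] (h : IsFullyRandom μ f) (hx : Function.Injective x)
    (hy : y ∉ Set.range x) (F : (Fin n → Fingerprint m r) → Fingerprint m r → ℝ) :
    ∫ ω, F (fun i => f (x i) ω) (f y ω) ∂μ =
      (∑ g, ∑ φ, F g φ) / (Fintype.card (Fingerprint m r) : ℝ) ^ (n + 1) := by
  let z : Fin (n + 1) → U := Fin.snoc x y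
  have hz : Function.Injective z := Fin.snoc_injective_iff.2 ⟨hx, hy⟩
  let Z : Ω → Fin (n + 1) → Fingerprint m r := fun ω i => f (z i) ω
  let G : (Fin (n + 1) → Fingerprint m r) → ℝ := fun g =>
    F ((Fin.last n).removeNth g) (g (Fin.last n))
  have hZ : Measurable Z := measurable_pi_lambda _ fun i => h.measurable (z i)
  have hF : ∀ ω, F (fun i => f (x i) ω) (f y ω) = G (Z ω) := by
    intro ω
    simp only [G, Fin.removeNth_last]
    congr 1
    · funext i
      simp [Z, z, Fin.init]
    · simp [Z, z]
  simp only [hF]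
  have hprob : IsProbabilityMeasure (μ.map Z) := Measure.isProbabilityMeasure_map hZ.aemeasurable
  rw [← integral_map (f := G) hZ.aemeasurable (measurable_of_finite G).aestronglyMeasurable,
    integral_fintype Integrable.of_finite]
  have hreal : ∀ a, (μ.map Z).real {a} =
      1 / (Fintype.card (Fingerprint m r) : ℝ) ^ (n + 1) := fun a => by
    rw [map_measureReal_apply hZ (measurableSet_singleton a)]
    exact h.measureReal_preimage hz a
  simp only [hreal, smul_eq_mul]
  rw [← Finset.mul_sum, sum_removeNth (Fin.last n) fun φ g => F g φ, Finset.sum_comm,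
    one_div_mul_eq_div]

variable [NeZero m] [IsProbabilityMeasure μ]

theorem integral_numProbes (h : IsFullyRandom μ f) (hx : Function.Injective x)
    (hy : y ∉ Set.range x) (hn : n < m) :
    ∫ ω, ((lpFilter f x ω).numProbes (f y ω) : ℝ) ∂μ =
      1 / 2 * (1 + m * (knuthQ m (n + 1) - knuthQ m n)) := by
  have hN : (Fintype.card (Fingerprint m r) : ℝ) ≠ 0 := by
    rw [card_fingerprint]
    exact mul_ne_zero (Nat.cast_ne_zero.2 (NeZero.ne m)) (remainder_count_pos r).ne'
  have h1 := h.integral_eq hx hy fun g φ => ((LPTable.build (List.ofFn g)).numProbes φ : ℝ)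
  refine h1.trans ?_
  simp only [LPTable.numProbes, Nat.cast_add, Nat.cast_one, Finset.sum_add_distrib]
  rw [sum_distToEmpty_eq hn]
  simp only [Finset.sum_const, Finset.card_univ, nsmul_eq_mul, mul_one, Fintype.card_fun,
    Fintype.card_fin, Nat.cast_pow]
  rw [← pow_succ]
  field_simp
  ring

theorem falsePositiveRate_eq (h : IsFullyRandom μ f) (hx : Function.Injective x)
    (hy : y ∉ Set.range x) :
    falsePositiveRate μ f x y =
      (∫ ω, ((lpFilter f x ω).numComparisonsUntilMatch (f y ω) : ℝ) ∂μ) /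
        ((2 : ℝ) ^ (r + 3) - 1) := by
  classical
  have h1 := h.integral_eq hx hy fun g φ =>
    ((LPTable.build (List.ofFn g)).numComparisonsUntilMatch φ : ℝ)
  have h2 := h.integral_eq hx hy fun g φ =>
    if (LPTable.build (List.ofFn g)).Query φ then (1 : ℝ) else 0
  -- The symmetry argument fixes the fingerprint of `y` and lets the table vary.
  rw [Finset.sum_comm] at h1 h2
  simp only [LPTable.sum_numComparisonsUntilMatch] at h1
  rw [← Finset.mul_sum, card_remainder] at h1
  have hmeas : MeasurableSet {ω | (lpFilter f x ω).Query (f y ω)} := by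
    have hZ : Measurable fun ω => ((fun i => f (x i) ω : Fin n → Fingerprint m r), f y ω) :=
      (measurable_pi_lambda _ fun i => h.measurable (x i)).prodMk (h.measurable y)
    exact hZ (Set.toFinite {p : (Fin n → Fingerprint m r) × Fingerprint m r |
      (LPTable.build (List.ofFn p.1)).Query p.2}).measurableSet
  have h3 : falsePositiveRate μ f x y =
      ∫ ω, if (lpFilter f x ω).Query (f y ω) then (1 : ℝ) else 0 ∂μ := by
    rw [falsePositiveRate, ← integral_indicator_one hmeas]
    rfl
  have h4 := (remainder_count_pos r).ne'
  rw [h3]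
  refine h2.trans ?_
  rw [show (∫ ω, ((lpFilter f x ω).numComparisonsUntilMatch (f y ω) : ℝ) ∂μ) = _ from h1]
  field_simp

theorem integral_mono (h : IsFullyRandom μ f) (hx : Function.Injective x)
    (hy : y ∉ Set.range x) {A B : LPTable m r → Fingerprint m r → ℕ} (hAB : ∀ T φ, A T φ ≤ B T φ) :
    (∫ ω, (A (lpFilter f x ω) (f y ω) : ℝ) ∂μ) ≤ ∫ ω, (B (lpFilter f x ω) (f y ω) : ℝ) ∂μ := by
  have h1 := h.integral_eq hx hy fun g φ => (A (LPTable.build (List.ofFn g)) φ : ℝ)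
  have h2 := h.integral_eq hx hy fun g φ => (B (LPTable.build (List.ofFn g)) φ : ℝ)
  refine h1.trans_le (le_trans ?_ h2.symm.le)
  gcongr
  exact hAB _ _

end IsFullyRandom

theorem corollary1 :
    -- the false positive rate and its bound, for every table and every number of elements
    (∀ (Ω : Type*) [MeasurableSpace Ω] (μ : Measure Ω) [IsProbabilityMeasure μ] (U : Type*)
      (m r n : ℕ) [NeZero m] (f : U → Ω → Fingerprint m r) (x : Fin n → U) (y : U),
      IsFullyRandom μ f → Function.Injective x → y ∉ Set.range x → n < m →
        falsePositiveRate μ f x y =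
            (∫ ω, ((lpFilter f x ω).numComparisonsUntilMatch (f y ω) : ℝ) ∂μ) /
              ((2 : ℝ) ^ (r + 3) - 1) ∧
        falsePositiveRate μ f x y ≤
            (∫ ω, ((lpFilter f x ω).numComparisons (f y ω) : ℝ) ∂μ) /
              ((2 : ℝ) ^ (r + 3) - 1) ∧
        (∫ ω, ((lpFilter f x ω).numComparisons (f y ω) : ℝ) ∂μ) ≤
            ∫ ω, ((lpFilter f x ω).numProbes (f y ω) : ℝ) ∂μ ∧
        (∫ ω, ((lpFilter f x ω).numProbes (f y ω) : ℝ) ∂μ) ≤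
            1 / 2 * (1 + 1 / (1 - (n : ℝ) / m) ^ 2) ∧
        falsePositiveRate μ f x y ≤
            1 / 2 * (1 + 1 / (1 - (n : ℝ) / m) ^ 2) * (1 / ((2 : ℝ) ^ (r + 3) - 1))) ∧
    -- the bound on the expected number of probes is attained asymptotically, uniformly for all
    -- fill degrees bounded away from 1
    (∀ (δ₀ ε : ℝ), δ₀ < 1 → 0 < ε → ∃ M : ℕ,
      ∀ (Ω : Type*) [MeasurableSpace Ω] (μ : Measure Ω) [IsProbabilityMeasure μ] (U : Type*)
        (m r n : ℕ) [NeZero m] (f : U → Ω → Fingerprint m r) (x : Fin n → U) (y : U),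
        IsFullyRandom μ f → Function.Injective x → y ∉ Set.range x →
          M ≤ m → (n : ℝ) / m ≤ δ₀ →
          1 / 2 * (1 + 1 / (1 - (n : ℝ) / m) ^ 2) - ε ≤
            ∫ ω, ((lpFilter f x ω).numProbes (f y ω) : ℝ) ∂μ) := by
  constructor
  · intro Ω _ μ _ U m r n _ f x y h hx hy hn
    have hR := remainder_count_pos r
    have hm : (0 : ℝ) < m := Nat.cast_pos.2 (by omega)
    have h1 := h.falsePositiveRate_eq hx hy
    have h2 : falsePositiveRate μ f x y ≤
        (∫ ω, ((lpFilter f x ω).numComparisons (f y ω) : ℝ) ∂μ) / ((2 : ℝ) ^ (r + 3) - 1) := by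
      rw [h1]
      refine div_le_div_of_nonneg_right (h.integral_mono hx hy fun T φ => ?_) hR.le
      exact (Finset.card_filter_le _ _).trans (Finset.card_range _).le
    have h3 : (∫ ω, ((lpFilter f x ω).numComparisons (f y ω) : ℝ) ∂μ) ≤
        ∫ ω, ((lpFilter f x ω).numProbes (f y ω) : ℝ) ∂μ :=
      h.integral_mono hx hy fun T φ => Nat.le_succ _
    have h4 : (∫ ω, ((lpFilter f x ω).numProbes (f y ω) : ℝ) ∂μ) ≤
        1 / 2 * (1 + 1 / (1 - (n : ℝ) / m) ^ 2) := by
      rw [h.integral_numProbes hx hy hn]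
      have := knuthQ_diff_le hm n (Nat.cast_lt.2 hn)
      gcongr
    refine ⟨h1, h2, h3, h4, h2.trans ?_⟩
    rw [div_eq_mul_one_div]
    exact mul_le_mul_of_nonneg_right (h3.trans h4) (one_div_pos.2 hR).le
  · intro δ₀ ε hδ hε
    have ha : 0 < 1 - δ₀ := sub_pos.2 hδ
    -- Makes the error `(3 / a ^ 4) / m` of `le_knuthQ_diff`, with `a = 1 - δ₀`, at most `ε`.
    refine ⟨⌈(3 / (1 - δ₀) ^ 4) / ε⌉₊, ?_⟩
    intro Ω _ μ _ U m r n _ f x y h hx hy hM hn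
    have hm : (0 : ℝ) < m := Nat.cast_pos.2 (Nat.pos_of_ne_zero (NeZero.ne m))
    have hnm : n < m := by
      have := hn.trans_lt hδ
      rw [div_lt_one hm] at this
      exact_mod_cast this
    have h1 := le_knuthQ_diff hm ha n (by linarith)
    have h2 : (3 / (1 - δ₀) ^ 4) / m ≤ ε := by
      rw [div_le_iff₀ hm, mul_comm, ← div_le_iff₀ hε]
      exact (Nat.le_ceil _).trans (by exact_mod_cast hM)
    rw [h.integral_numProbes hx hy hnm]
    linarith
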